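/- Let $Q$ be a finite quiver (finitely many vertices and finitely many arrows) that is acyclic, i.e. has no oriented cycles. Let $\Phi$ be an exact $Q^{\mathrm{op}}$-diagram of Grothendieck categories: a Grothendieck abelian category $\Phi_i$ for every vertex $i$ of $Q$ and an exact functor $\Phi_a:\Phi_j\to\Phi_i$ for every arrow $a:i\to j$ of $Q$. Let $\mathrm{dRep}(\Phi)$ be the category whose objects $X$ consist of objects $X_i\in\Phi_i$ for all vertices $i$ and morphisms $X_a:X_i\to\Phi_a X_j$ for all arrows $a:i\to j$, and whose morphisms $f:X\to Y$ are families of morphisms $f_i:X_i\to Y_i$ with $Y_a\circ f_i=\Phi_a(f_j)\circ X_a$ for all arrows $a:i\to j$; it is an abelian category, with kernels and cokernels computed componentwise. Then for all $X,Y\in\mathrm{dRep}(\Phi)$ there is a long exact sequence of abelian groups $$0\to\mathrm{Hom}(X,Y)\to\bigoplus_{i}\mathrm{Hom}_{\Phi_i}(X_i,Y_i)\to\bigoplus_{a:i\to j}\mathrm{Hom}_{\Phi_i}(X_i,\Phi_aY_j)\to\mathrm{Ext}^1(X,Y)\to\bigoplus_{i}\mathrm{Ext}^1_{\Phi_i}(X_i,Y_i)\to\bigoplus_{a:i\to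 j}\mathrm{Ext}^1_{\Phi_i}(X_i,\Phi_aY_j)\to\mathrm{Ext}^2(X,Y)\to\cdots$$ continuing in all degrees, where $\mathrm{Hom}(X,Y)$ and $\mathrm{Ext}^n(X,Y)$ are taken in $\mathrm{dRep}(\Phi)$, the maps $\mathrm{Ext}^n(X,Y)\to\bigoplus_i\mathrm{Ext}^n_{\Phi_i}(X_i,Y_i)$ are induced by the exact functors $X\mapsto X_i$, and the maps $\bigoplus_i\mathrm{Ext}^n_{\Phi_i}(X_i,Y_i)\to\bigoplus_{a:i\to j}\mathrm{Ext}^n_{\Phi_i}(X_i,\Phi_aY_j)$ send $(e_i)_i$ to $(\Phi_a(e_j)\circ X_a-Y_a\circ e_i)_{a:i\to j}$ (with $\mathrm{Ext}^0=\mathrm{Hom}$). -/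

import Mathlib

open CategoryTheory CategoryTheory.Limits CategoryTheory.Abelian

universe w v u v₁ u₁

attribute [-instance] catToReflQuiver

/-- A quiver is acyclic if it has no oriented cycles: every path from a vertex to itself
is trivial. -/
def IsAcyclicQuiver (Q : Type u₁) [Quiver.{v₁} Q] : Prop :=
  ∀ (i : Q) (p : Quiver.Path i i), p = Quiver.Path.nil

/-- A `Qᵒᵖ`-diagram of categories: a category `Φ_i` for every vertex `i` and a functor
`Φ_a : Φ_j ⥤ Φ_i` for every arrow `a : i ⟶ j`. As the path category of `Q` is free on `Q`, this
is the same as a contravariant functor from the path category of `Q` to categories. -/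
structure QuiverDiagram (Q : Type u₁) [Quiver.{v₁} Q] where
  /-- the category `Φ_i` attached to a vertex -/
  obj : Q → Type u
  [category : ∀ i, Category.{v} (obj i)]
  /-- the functor `Φ_a : Φ_j ⥤ Φ_i` attached to an arrow `a : i ⟶ j` -/
  map : ∀ {i j : Q}, (i ⟶ j) → (obj j ⥤ obj i)

namespace QuiverDiagram

attribute [instance] QuiverDiagram.category

variable {Q : Type u₁} [Quiver.{v₁} Q]

/-- A diagram is left exact if all the functors `Φ_a` are left exact. -/
class IsLeftExact (Φ : QuiverDiagram.{v, u} Q) : Prop where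
  preservesFiniteLimits : ∀ {i j : Q} (a : i ⟶ j), PreservesFiniteLimits (Φ.map a)

/-- A diagram is exact if all the functors `Φ_a` are left exact and right exact. -/
class IsExact (Φ : QuiverDiagram.{v, u} Q) : Prop extends IsLeftExact Φ where
  preservesFiniteColimits : ∀ {i j : Q} (a : i ⟶ j), PreservesFiniteColimits (Φ.map a)

attribute [instance] IsLeftExact.preservesFiniteLimits IsExact.preservesFiniteColimits

/-- A (twisted) representation `X` of `Q`: objects `X_i` of `Φ_i` for all vertices `i` and morphisms
`X_a : X_i ⟶ Φ_a X_j` in `Φ_i` for all arrows `a : i ⟶ j`. -/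
structure DRep (Φ : QuiverDiagram.{v, u} Q) where
  /-- the component `X_i` -/
  obj : ∀ i : Q, Φ.obj i
  /-- the structure morphism `X_a` -/
  map : ∀ {i j : Q} (a : i ⟶ j), obj i ⟶ (Φ.map a).obj (obj j)

namespace DRep

variable {Φ : QuiverDiagram.{v, u} Q}

/-- A morphism of representations: morphisms `f_i : X_i ⟶ Y_i` such that
`Y_a ∘ f_i = Φ_a(f_j) ∘ X_a` for every arrow `a : i ⟶ j`. -/
@[ext]
structure Hom (X Y : DRep Φ) where
  /-- the component `f_i` -/
  app : ∀ i : Q, X.obj i ⟶ Y.obj i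
  comm : ∀ {i j : Q} (a : i ⟶ j), app i ≫ Y.map a = X.map a ≫ (Φ.map a).map (app j)

lemma Hom.comm_assoc {X Y : DRep Φ} (f : Hom X Y) {i j : Q} (a : i ⟶ j) {Z : Φ.obj i}
    (h : (Φ.map a).obj (Y.obj j) ⟶ Z) :
    f.app i ≫ Y.map a ≫ h = X.map a ≫ (Φ.map a).map (f.app j) ≫ h := by
  rw [← Category.assoc, f.comm, Category.assoc]

instance : Category (DRep Φ) where
  Hom := Hom
  id X := { app := fun i => 𝟙 (X.obj i), comm := by simp }
  comp f g :=
    { app := fun i => f.app i ≫ g.app i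
      comm := fun a => by rw [Category.assoc, g.comm, f.comm_assoc, Functor.map_comp] }

@[simp] lemma id_app (X : DRep Φ) (i : Q) : (𝟙 X : X ⟶ X).app i = 𝟙 (X.obj i) := rfl

@[simp] lemma comp_app {X Y Z : DRep Φ} (f : X ⟶ Y) (g : Y ⟶ Z) (i : Q) :
    (f ≫ g).app i = f.app i ≫ g.app i := rfl

@[ext] lemma hom_ext {X Y : DRep Φ} {f g : X ⟶ Y} (h : ∀ i, f.app i = g.app i) : f = g :=
  Hom.ext (funext h)

variable (Φ) in
/-- The forgetful functor `X ↦ X_i`. -/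
@[simps]
def eval (i : Q) : DRep Φ ⥤ Φ.obj i where
  obj X := X.obj i
  map f := f.app i

lemma isIso_of_app {X Y : DRep Φ} (f : X ⟶ Y) (h : ∀ i, IsIso (f.app i)) : IsIso f :=
  ⟨{ app := fun i => inv (f.app i)
     comm := fun {i j} a => by
      rw [IsIso.inv_comp_eq, ← Category.assoc, f.comm, Category.assoc, ← Functor.map_comp,
        IsIso.hom_inv_id, CategoryTheory.Functor.map_id, Category.comp_id] },
    by ext i; exact IsIso.hom_inv_id _, by ext i; exact IsIso.inv_hom_id _⟩

section Limits

variable {J : Type*} [Category* J] (F : J ⥤ DRep Φ)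

/-- A cone of representations whose components are limit cones is a limit cone. -/
def isLimitOfEval [∀ {i j : Q} (a : i ⟶ j), PreservesLimitsOfShape J (Φ.map a)] (s : Cone F)
    (hs : ∀ i, IsLimit ((eval Φ i).mapCone s)) : IsLimit s :=
  let l (t : Cone F) (i : Q) : t.pt.obj i ⟶ s.pt.obj i := (hs i).lift ((eval Φ i).mapCone t)
  have hl (t : Cone F) (i : Q) (k : J) : l t i ≫ (s.π.app k).app i = (t.π.app k).app i :=
    (hs i).fac ((eval Φ i).mapCone t) k
  { lift := fun t =>
      { app := l t
        comm := fun {i j} a => by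
          apply (isLimitOfPreserves (Φ.map a) (hs j)).hom_ext
          intro k
          change (l t i ≫ s.pt.map a) ≫ (Φ.map a).map ((s.π.app k).app j) =
            (t.pt.map a ≫ (Φ.map a).map (l t j)) ≫ (Φ.map a).map ((s.π.app k).app j)
          have e := (s.π.app k).comm a
          have e' := (t.π.app k).comm a
          dsimp only [Functor.const_obj_obj] at e e'
          rw [Category.assoc, ← e, ← Category.assoc, hl, Category.assoc, ← Functor.map_comp, hl,
            e'] }
    fac := fun t k => hom_ext fun i => hl t i k
    uniq := fun t m hm => hom_ext fun i =>
      (hs i).uniq ((eval Φ i).mapCone t) (m.app i) fun k => congrArg (fun f => Hom.app f i) (hm k) }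

/-- A cocone of representations whose components are colimit cocones is a colimit cocone. -/
def isColimitOfEval (s : Cocone F) (hs : ∀ i, IsColimit ((eval Φ i).mapCocone s)) :
    IsColimit s :=
  let d (t : Cocone F) (i : Q) : s.pt.obj i ⟶ t.pt.obj i := (hs i).desc ((eval Φ i).mapCocone t)
  have hd (t : Cocone F) (i : Q) (k : J) : (s.ι.app k).app i ≫ d t i = (t.ι.app k).app i :=
    (hs i).fac ((eval Φ i).mapCocone t) k
  { desc := fun t =>
      { app := d t
        comm := fun {i j} a => by
          apply (hs i).hom_ext
          intro k
          change (s.ι.app k).app i ≫ d t i ≫ t.pt.map a =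
            (s.ι.app k).app i ≫ s.pt.map a ≫ (Φ.map a).map (d t j)
          have e := (s.ι.app k).comm_assoc a ((Φ.map a).map (d t j))
          have e' := (t.ι.app k).comm a
          dsimp only [Functor.const_obj_obj] at e e'
          rw [← Category.assoc, hd, e, e', ← Functor.map_comp, hd] }
    fac := fun t k => hom_ext fun i => hd t i k
    uniq := fun t m hm => hom_ext fun i =>
      (hs i).uniq ((eval Φ i).mapCocone t) (m.app i) fun k =>
        congrArg (fun f => Hom.app f i) (hm k) }

/-- The componentwise limit cone. -/
noncomputable def limitCone [∀ i, HasLimitsOfShape J (Φ.obj i)]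
    [∀ {i j : Q} (a : i ⟶ j), PreservesLimitsOfShape J (Φ.map a)] : Cone F :=
  let p (i : Q) (k : J) : limit (F ⋙ eval Φ i) ⟶ (F.obj k).obj i := limit.π (F ⋙ eval Φ i) k
  have hp (i : Q) {k l : J} (f : k ⟶ l) : p i k ≫ (F.map f).app i = p i l :=
    limit.w (F ⋙ eval Φ i) f
  let c {i j : Q} (a : i ⟶ j) : Cone ((F ⋙ eval Φ j) ⋙ Φ.map a) :=
    { pt := limit (F ⋙ eval Φ i)
      π :=
        { app := fun k => p i k ≫ (F.obj k).map a
          naturality := fun k l f => by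
            change 𝟙 _ ≫ p i l ≫ (F.obj l).map a =
              (p i k ≫ (F.obj k).map a) ≫ (Φ.map a).map ((F.map f).app j)
            rw [Category.id_comp, Category.assoc, ← (F.map f).comm, ← Category.assoc, hp] } }
  { pt :=
      { obj := fun i => limit (F ⋙ eval Φ i)
        map := fun {i j} a =>
          (isLimitOfPreserves (Φ.map a) (limit.isLimit (F ⋙ eval Φ j))).lift (c a) }
    π :=
      { app := fun k =>
          { app := fun i => p i k
            comm := fun {i j} a =>
              ((isLimitOfPreserves (Φ.map a) (limit.isLimit (F ⋙ eval Φ j))).fac (c a) k).symm }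
        naturality := fun k l f => hom_ext fun i =>
          (Category.id_comp (p i l)).trans (hp i f).symm } }

/-- The componentwise colimit cocone. -/
noncomputable def colimitCocone [∀ i, HasColimitsOfShape J (Φ.obj i)] : Cocone F :=
  let q (i : Q) (k : J) : (F.obj k).obj i ⟶ colimit (F ⋙ eval Φ i) := colimit.ι (F ⋙ eval Φ i) k
  have hq (i : Q) {k l : J} (f : k ⟶ l) : (F.map f).app i ≫ q i l = q i k :=
    colimit.w (F ⋙ eval Φ i) f
  { pt :=
      { obj := fun i => colimit (F ⋙ eval Φ i)
        map := fun {i j} a =>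
          colimit.desc (F ⋙ eval Φ i)
            { pt := (Φ.map a).obj (colimit (F ⋙ eval Φ j))
              ι :=
                { app := fun k => (F.obj k).map a ≫ (Φ.map a).map (q j k)
                  naturality := fun k l f => by
                    change (F.map f).app i ≫ (F.obj l).map a ≫ (Φ.map a).map (q j l) =
                      ((F.obj k).map a ≫ (Φ.map a).map (q j k)) ≫ 𝟙 _
                    rw [Category.comp_id, (F.map f).comm_assoc, ← Functor.map_comp, hq] } } }
    ι :=
      { app := fun k =>
          { app := fun i => q i k
            comm := fun {i j} a => colimit.ι_desc _ k }
        naturality := fun k l f => hom_ext fun i =>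
          (hq i f).trans (Category.comp_id (q i k)).symm } }

noncomputable def isLimitLimitCone [∀ i, HasLimitsOfShape J (Φ.obj i)]
    [∀ {i j : Q} (a : i ⟶ j), PreservesLimitsOfShape J (Φ.map a)] : IsLimit (limitCone F) :=
  isLimitOfEval F _ fun i => limit.isLimit (F ⋙ eval Φ i)

noncomputable def isColimitColimitCocone [∀ i, HasColimitsOfShape J (Φ.obj i)] :
    IsColimit (colimitCocone F) :=
  isColimitOfEval F _ fun i => colimit.isColimit (F ⋙ eval Φ i)

end Limits

section Abelian

variable [∀ i, Abelian (Φ.obj i)] [Φ.IsLeftExact]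

instance map_additive {i j : Q} (a : i ⟶ j) : (Φ.map a).Additive :=
  Functor.additive_of_preserves_binary_products _

instance (X Y : DRep Φ) : AddCommGroup (X ⟶ Y) :=
  letI : Zero (X ⟶ Y) := ⟨⟨fun i => 0, fun a => by simp⟩⟩
  letI : Add (X ⟶ Y) := ⟨fun f g => ⟨fun i => f.app i + g.app i, fun a => by
    simp [f.comm, g.comm]⟩⟩
  letI : Neg (X ⟶ Y) := ⟨fun f => ⟨fun i => -f.app i, fun a => by simp [f.comm]⟩⟩
  { add_assoc := fun f g h => hom_ext fun i => add_assoc _ _ _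
    zero_add := fun f => hom_ext fun i => zero_add _
    add_zero := fun f => hom_ext fun i => add_zero _
    neg_add_cancel := fun f => hom_ext fun i => neg_add_cancel _
    add_comm := fun f g => hom_ext fun i => add_comm _ _
    nsmul := nsmulRec
    zsmul := zsmulRec }

@[simp] lemma add_app {X Y : DRep Φ} (f g : X ⟶ Y) (i : Q) :
    (f + g).app i = f.app i + g.app i := rfl

/-- Morphisms of representations are added componentwise. -/
instance : Preadditive (DRep Φ) where
  add_comp _ _ _ f g h := hom_ext fun i => Preadditive.add_comp _ _ _ _ _ _
  comp_add _ _ _ f g h := hom_ext fun i => Preadditive.comp_add _ _ _ _ _ _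

instance (i : Q) : (eval Φ i).Additive where

instance : HasFiniteLimits (DRep Φ) :=
  ⟨fun _ _ _ => ⟨fun F => ⟨⟨⟨_, isLimitLimitCone F⟩⟩⟩⟩⟩

instance : HasFiniteColimits (DRep Φ) :=
  ⟨fun _ _ _ => ⟨fun F => ⟨⟨⟨_, isColimitColimitCocone F⟩⟩⟩⟩⟩

instance (i : Q) : PreservesFiniteLimits (eval Φ i) :=
  ⟨fun _ _ _ => ⟨fun {F} => preservesLimit_of_preserves_limit_cone (isLimitLimitCone F)
    (limit.isLimit (F ⋙ eval Φ i))⟩⟩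

instance (i : Q) : PreservesFiniteColimits (eval Φ i) :=
  ⟨fun _ _ _ => ⟨fun {F} => preservesColimit_of_preserves_colimit_cocone
    (isColimitColimitCocone F) (colimit.isColimit (F ⋙ eval Φ i))⟩⟩

instance {X Y : DRep Φ} (f : X ⟶ Y) : IsIso (Abelian.coimageImageComparison f) :=
  isIso_of_app _ fun i =>
    have h : IsIso ((eval Φ i).map (Abelian.coimageImageComparison f)) :=
      IsIso.of_isIso_fac_right
        (Abelian.PreservesCoimage.hom_coimageImageComparison (eval Φ i) f).symm
    h

/-- The category of representations of a left exact diagram of abelian categories is abelian. -/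
noncomputable instance : Abelian (DRep Φ) := Abelian.ofCoimageImageComparisonIsIso

/-- Being abelian, the category of representations has `Ext`-groups, in a large enough universe. -/
instance : HasExt.{max u₁ v₁ u v} (DRep Φ) := HasExt.standard _

end Abelian

section Sequence

variable [∀ i, Abelian (Φ.obj i)]

/-- The map `Hom(X, Y) → ⨁_i Hom(X_i, Y_i)`, `f ↦ (f_i)_i`. -/
def homRestrict [Φ.IsLeftExact] (X Y : DRep Φ) :
    (X ⟶ Y) →+ ∀ i : Q, (X.obj i ⟶ Y.obj i) where
  toFun f i := f.app i
  map_zero' := rfl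
  map_add' _ _ := rfl

/-- The map `⨁_i Hom(X_i, Y_i) → ⨁_{a : i ⟶ j} Hom(X_i, Φ_a Y_j)`,
`f ↦ (Φ_a(f_j) ∘ X_a - Y_a ∘ f_i)_a`. -/
def homDiff [Φ.IsLeftExact] (X Y : DRep Φ) :
    (∀ i : Q, (X.obj i ⟶ Y.obj i)) →+
      ∀ a : Quiver.Total Q, (X.obj a.left ⟶ (Φ.map a.hom).obj (Y.obj a.right)) where
  toFun f a := X.map a.hom ≫ (Φ.map a.hom).map (f a.right) - f a.left ≫ Y.map a.hom
  map_zero' := by ext a; simp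
  map_add' f g := by ext a; simp; abel

variable [∀ i, IsGrothendieckAbelian.{w} (Φ.obj i)]

/-- The map `Extⁿ(X, Y) → ⨁_i Extⁿ(X_i, Y_i)` induced by the exact functors `X ↦ X_i`. -/
noncomputable def extRestrict [Φ.IsLeftExact] (X Y : DRep Φ) (n : ℕ) :
    Ext.{max u₁ v₁ u v} X Y n →+ ∀ i : Q, Ext.{w} (X.obj i) (Y.obj i) n :=
  AddMonoidHom.pi fun i => (eval Φ i).mapExtAddHom X Y n

/-- The map `⨁_i Extⁿ(X_i, Y_i) → ⨁_{a : i ⟶ j} Extⁿ(X_i, Φ_a Y_j)`,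
`e ↦ (Φ_a(e_j) ∘ X_a - Y_a ∘ e_i)_a`, where `Φ_a` acts on `Ext` because it is exact. -/
noncomputable def extDiff [Φ.IsExact] (X Y : DRep Φ) (n : ℕ) :
    (∀ i : Q, Ext.{w} (X.obj i) (Y.obj i) n) →+
      ∀ a : Quiver.Total Q, Ext.{w} (X.obj a.left) ((Φ.map a.hom).obj (Y.obj a.right)) n :=
  AddMonoidHom.pi fun a =>
    ((Ext.precomp (Ext.mk₀ (X.map a.hom)) _ (zero_add n)).comp
      ((Φ.map a.hom).mapExtAddHom _ _ n)).comp (Pi.evalAddMonoidHom _ a.right) -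
    (Ext.postcomp (Ext.mk₀ (Y.map a.hom)) _ (add_zero n)).comp (Pi.evalAddMonoidHom _ a.left)

end Sequence

end DRep

end QuiverDiagram

-- The evaluations `X ↦ X_k` have a joint right adjoint: the cofree representation on objects `V_k`
-- has at `k` the sum, over paths `p` starting at `k`, of the value of the composite functor along
-- `p` at the object of its endpoint. Finiteness and acyclicity make these sums finite. The
-- adjunction gives `Hom(X, cofree V) = ∏ Hom(X_k, V_k)`, and cofree representations on injectives
-- are injective. Right exactness of the `Φ_a` makes the construction exact, so dimension shifting
-- yields `Extⁿ(X, cofree V) = ∏ Extⁿ(X_k, V_k)` (`extCofree_bijective`).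
--
-- Every `Y` has a two-term coresolution `0 → Y → cofree(Y_k)_k → cofree(Φ_a Y_j)_a → 0`
-- (`shortExact_cofreeResolution`), and the theorem is the long exact sequence of `Ext(X, -)` for
-- it. Naming the maps requires that the components of a class in `Extⁿ(X, Y)` commute with the
-- structure maps (`extEval_comp_map`).
--
-- The label type `T` lets a vertex carry several objects: one for the middle term, one per outgoing
-- arrow for the last.

universe t

set_option linter.unusedSectionVars false

/-! ### Paths in a finite acyclic quiver -/

namespace QuiverDiagram

variable {Q : Type u₁} [Quiver.{v₁} Q]

/-- Paths starting at a given vertex, with an element of `T` attached to the endpoint. -/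
inductive OutPath (T : Q → Type t) : Q → Type (max u₁ v₁ t)
  | nil {k : Q} (t : T k) : OutPath T k
  | cons {k j : Q} (a : k ⟶ j) (p : OutPath T j) : OutPath T k

lemma OutPath.cons_injective {T : Q → Type t} {k j : Q} (a : k ⟶ j) :
    Function.Injective (OutPath.cons (T := T) a) := by
  intro p q h
  cases h
  rfl

/-- In a finite acyclic quiver, the relation "there is an arrow to" is well founded. -/
lemma wellFounded_of_isAcyclicQuiver [Finite Q] (hQ : IsAcyclicQuiver Q) :
    WellFounded fun j k : Q => Nonempty (k ⟶ j) := by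
  -- Existence of a nontrivial path from `k` to `j`: transitive by concatenation, irreflexive by
  -- acyclicity, hence well founded on a finite set.
  let r : Q → Q → Prop := fun j k => ∃ l : Q, Nonempty (k ⟶ l) ∧ Nonempty (Quiver.Path l j)
  have htrans : IsTrans Q r := ⟨fun _ _ _ => by
    rintro ⟨l, ⟨a⟩, ⟨p⟩⟩ ⟨l', ⟨a'⟩, ⟨p'⟩⟩
    exact ⟨l', ⟨a'⟩, ⟨(p'.comp a.toPath).comp p⟩⟩⟩
  have hirrefl : Std.Irrefl r := ⟨fun k => by
    rintro ⟨l, ⟨a⟩, ⟨p⟩⟩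
    have h := congrArg Quiver.Path.length (hQ k (a.toPath.comp p))
    rw [Quiver.Path.length_comp, Quiver.Path.length_toPath, Quiver.Path.length_nil] at h
    omega⟩
  exact Subrelation.wf (r := r) (fun {j k} h => ⟨j, h, ⟨Quiver.Path.nil⟩⟩)
    (Finite.wellFounded_of_trans_of_irrefl r)

instance finite_sigma_hom [Finite (Quiver.Total Q)] (k : Q) : Finite (Σ j, (k ⟶ j)) :=
  Finite.of_injective (fun a => (⟨k, a.1, a.2⟩ : Quiver.Total Q)) <| by
    rintro ⟨j, a⟩ ⟨j', a'⟩ h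
    cases h
    rfl

/-- A path is a label at `k` or one of finitely many arrows followed by a path from its target, so
well-founded induction along arrows applies. -/
lemma OutPath.finite [Finite Q] [Finite (Quiver.Total Q)] (hQ : IsAcyclicQuiver Q)
    (T : Q → Type t) [∀ k, Finite (T k)] (k : Q) : Finite (OutPath T k) := by
  induction k using (wellFounded_of_isAcyclicQuiver hQ).induction with
  | _ k ih =>
    have (a : Σ j, (k ⟶ j)) : Finite (OutPath T a.1) := ih a.1 ⟨a.2⟩
    refine Finite.of_surjective
      (Sum.elim OutPath.nil (fun x => OutPath.cons x.1.2 x.2) :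
        T k ⊕ (Σ a : Σ j, (k ⟶ j), OutPath T a.1) → OutPath T k) ?_
    rintro (t | ⟨a, p⟩)
    · exact ⟨.inl t, rfl⟩
    · exact ⟨.inr ⟨⟨_, a⟩, p⟩, rfl⟩

namespace DRep

variable {Φ : QuiverDiagram.{v, u} Q} {T : Q → Type t}

/-- The value at the starting point of a path of an object attached to its endpoint. -/
def pathObj (V : ∀ k, T k → Φ.obj k) : ∀ {k : Q}, OutPath T k → Φ.obj k
  | _, .nil t => V _ t
  | _, .cons a p => (Φ.map a).obj (pathObj V p)

/-- The functoriality of `pathObj`. -/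
def pathMap {V V' : ∀ k, T k → Φ.obj k} (f : ∀ k t, V k t ⟶ V' k t) :
    ∀ {k : Q} (p : OutPath T k), pathObj V p ⟶ pathObj V' p
  | _, .nil t => f _ t
  | _, .cons a p => (Φ.map a).map (pathMap f p)

lemma epi_pathMap [∀ i, Abelian (Φ.obj i)] [Φ.IsExact]
    {V V' : ∀ k, T k → Φ.obj k} (f : ∀ k t, V k t ⟶ V' k t)
    [∀ k t, Epi (f k t)] {k : Q} (p : OutPath T k) : Epi (pathMap f p) := by
  induction p with
  | nil t => exact inferInstanceAs (Epi (f _ t))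
  | cons a p ih => exact inferInstanceAs (Epi ((Φ.map a).map (pathMap f p)))

/-- The components of the morphism to a cofree representation. -/
def pathLift {X : DRep Φ} {V : ∀ k, T k → Φ.obj k} (f : ∀ k t, X.obj k ⟶ V k t) :
    ∀ {k : Q} (p : OutPath T k), X.obj k ⟶ pathObj V p
  | _, .nil t => f _ t
  | _, .cons a p => X.map a ≫ (Φ.map a).map (pathLift f p)

lemma mono_of_app {X Y : DRep Φ} (f : X ⟶ Y) (h : ∀ i, Mono (f.app i)) : Mono f :=
  ⟨fun g g' e => hom_ext fun i => by
    rw [← cancel_mono (f.app i)]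
    exact congrArg (fun m => Hom.app m i) e⟩

lemma epi_of_app {X Y : DRep Φ} (f : X ⟶ Y) (h : ∀ i, Epi (f.app i)) : Epi f :=
  ⟨fun g g' e => hom_ext fun i => by
    rw [← cancel_epi (f.app i)]
    exact congrArg (fun m => Hom.app m i) e⟩

variable [∀ i, Abelian (Φ.obj i)] [Φ.IsLeftExact]

instance {X Y : DRep Φ} (f : X ⟶ Y) [Mono f] (i : Q) : Mono (f.app i) :=
  inferInstanceAs (Mono ((eval Φ i).map f))

@[simp] lemma zero_app (X Y : DRep Φ) (i : Q) : (0 : X ⟶ Y).app i = 0 := rfl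

/-! ### Cofree representations and their universal property -/

section Cofree

variable [∀ k, Finite (OutPath T k)] (V : ∀ k, T k → Φ.obj k)

attribute [local instance] Fintype.ofFinite Abelian.hasFiniteBiproducts

/-- The cofree representation on a family of objects attached to the vertices. -/
noncomputable def cofree : DRep Φ where
  obj k := ⨁ fun p : OutPath T k => pathObj V p
  map {k j} a := ∑ p : OutPath T j,
    biproduct.π (fun p : OutPath T k => pathObj V p) (.cons a p) ≫
      (Φ.map a).map (biproduct.ι (fun p : OutPath T j => pathObj V p) p)

/-- The projection of a cofree representation on the summand attached to a path. -/
noncomputable def cofreeπ {k : Q} (p : OutPath T k) : (cofree V).obj k ⟶ pathObj V p :=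
  biproduct.π (fun p : OutPath T k => pathObj V p) p

/-- The inclusion in a cofree representation of the summand attached to a path. -/
noncomputable def cofreeι {k : Q} (p : OutPath T k) : pathObj V p ⟶ (cofree V).obj k :=
  biproduct.ι (fun p : OutPath T k => pathObj V p) p

/-- The counit of the cofree representation. -/
noncomputable def cofreeε (k : Q) (t : T k) : (cofree V).obj k ⟶ V k t :=
  cofreeπ V (.nil t)

variable {V}

lemma cofree_obj_hom_ext {k : Q} {Z : Φ.obj k} {f g : Z ⟶ (cofree V).obj k}
    (h : ∀ p, f ≫ cofreeπ V p = g ≫ cofreeπ V p) : f = g :=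
  biproduct.hom_ext _ _ h

lemma cofree_obj_hom_ext' {k : Q} {Z : Φ.obj k} {f g : (cofree V).obj k ⟶ Z}
    (h : ∀ p, cofreeι V p ≫ f = cofreeι V p ≫ g) : f = g :=
  biproduct.hom_ext' _ _ h

@[simp]
lemma cofreeι_π_self {k : Q} (p : OutPath T k) : cofreeι V p ≫ cofreeπ V p = 𝟙 _ :=
  biproduct.ι_π_self _ p

lemma cofreeι_π_ne {k : Q} {p q : OutPath T k} (h : p ≠ q) :
    cofreeι V p ≫ cofreeπ V q = 0 :=
  biproduct.ι_π_ne _ h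

lemma cofree_total (k : Q) : ∑ p : OutPath T k, cofreeπ V p ≫ cofreeι V p = 𝟙 _ := by
  refine cofree_obj_hom_ext fun q => ?_
  rw [Preadditive.sum_comp, Finset.sum_eq_single q]
  · rw [Category.assoc, cofreeι_π_self, Category.comp_id, Category.id_comp]
  · intro p _ h
    rw [Category.assoc, cofreeι_π_ne h, comp_zero]
  · simp

variable (V) in
/-- The projection of a cofree representation on the summand attached to a nontrivial path. -/
noncomputable def consπ {k j : Q} (a : k ⟶ j) (p : OutPath T j) :
    (cofree V).obj k ⟶ (Φ.map a).obj (pathObj V p) :=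
  cofreeπ V (.cons a p)

variable (V) in
/-- The inclusion in a cofree representation of the summand attached to a nontrivial path. -/
noncomputable def consι {k j : Q} (a : k ⟶ j) (p : OutPath T j) :
    (Φ.map a).obj (pathObj V p) ⟶ (cofree V).obj k :=
  cofreeι V (.cons a p)

@[simp]
lemma consι_π_self {k j : Q} (a : k ⟶ j) (p : OutPath T j) : consι V a p ≫ consπ V a p = 𝟙 _ :=
  cofreeι_π_self _

lemma consι_π_ne {k j : Q} (a : k ⟶ j) {p q : OutPath T j} (h : p ≠ q) :
    consι V a p ≫ consπ V a q = 0 :=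
  cofreeι_π_ne fun e => h (OutPath.cons_injective a e)

lemma consι_cofreeπ_ne {k j : Q} (a : k ⟶ j) {p : OutPath T j} {q : OutPath T k}
    (h : .cons a p ≠ q) : consι V a p ≫ cofreeπ V q = 0 :=
  cofreeι_π_ne h

variable (V) in
lemma cofree_map_eq {k j : Q} (a : k ⟶ j) :
    (cofree V).map a = ∑ p : OutPath T j, consπ V a p ≫ (Φ.map a).map (cofreeι V p) :=
  rfl

-- The structure map of a cofree representation deletes the first arrow of a path.
@[simp]
lemma cofree_map_comp_map_π {k j : Q} (a : k ⟶ j) (p : OutPath T j) :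
    (cofree V).map a ≫ (Φ.map a).map (cofreeπ V p) = consπ V a p := by
  rw [cofree_map_eq, Preadditive.sum_comp, Finset.sum_eq_single p]
  · rw [Category.assoc, ← Functor.map_comp, cofreeι_π_self, CategoryTheory.Functor.map_id,
      Category.comp_id]
  · intro q _ h
    rw [Category.assoc, ← Functor.map_comp, cofreeι_π_ne h, Functor.map_zero, comp_zero]
  · simp

/-- `Φ_a` is additive, so it carries the decomposition `cofree_total` of the identity to one of its
own. -/
lemma map_cofree_obj_hom_ext {k j : Q} (a : k ⟶ j) {Z : Φ.obj k}
    {f g : Z ⟶ (Φ.map a).obj ((cofree V).obj j)}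
    (h : ∀ p, f ≫ (Φ.map a).map (cofreeπ V p) = g ≫ (Φ.map a).map (cofreeπ V p)) : f = g := by
  rw [← Category.comp_id f, ← Category.comp_id g, ← CategoryTheory.Functor.map_id,
    ← cofree_total, Functor.map_sum, Preadditive.comp_sum, Preadditive.comp_sum]
  refine Finset.sum_congr rfl fun p _ => ?_
  rw [Functor.map_comp, ← Category.assoc, h, Category.assoc]

/-- The components of the morphism to a cofree representation. -/
noncomputable def cofreeLiftApp {X : DRep Φ} (f : ∀ k t, X.obj k ⟶ V k t) (k : Q) :
    X.obj k ⟶ (cofree V).obj k :=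
  biproduct.lift fun p : OutPath T k => pathLift f p

lemma cofreeLiftApp_π {X : DRep Φ} (f : ∀ k t, X.obj k ⟶ V k t) {k : Q} (p : OutPath T k) :
    cofreeLiftApp f k ≫ cofreeπ V p = pathLift f p :=
  biproduct.lift_π _ _

lemma cofreeLiftApp_consπ {X : DRep Φ} (f : ∀ k t, X.obj k ⟶ V k t) {k j : Q} (a : k ⟶ j)
    (p : OutPath T j) :
    cofreeLiftApp f k ≫ consπ V a p = X.map a ≫ (Φ.map a).map (pathLift f p) :=
  cofreeLiftApp_π _ _

/-- The morphism to a cofree representation with given components. -/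
noncomputable def cofreeLift {X : DRep Φ} (f : ∀ k t, X.obj k ⟶ V k t) : X ⟶ cofree V where
  app k := cofreeLiftApp f k
  comm {k j} a := by
    refine map_cofree_obj_hom_ext a fun p => ?_
    rw [Category.assoc, cofree_map_comp_map_π, Category.assoc, ← Functor.map_comp,
      cofreeLiftApp_π, cofreeLiftApp_consπ]

@[simp]
lemma cofreeLift_app_ε {X : DRep Φ} (f : ∀ k t, X.obj k ⟶ V k t) (k : Q) (t : T k) :
    (cofreeLift f).app k ≫ cofreeε V k t = f k t :=
  cofreeLiftApp_π f _

/-- Compatibility with structure maps forces the coordinate at a longer path from that at its tail;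
this drives the inductions on paths. -/
lemma app_comp_consπ {X : DRep Φ} (f : X ⟶ cofree V) {k j : Q} (a : k ⟶ j) (p : OutPath T j) :
    f.app k ≫ consπ V a p = X.map a ≫ (Φ.map a).map (f.app j ≫ cofreeπ V p) := by
  rw [← cofree_map_comp_map_π, f.comm_assoc, Functor.map_comp]

lemma cofree_hom_ext {X : DRep Φ} {f g : X ⟶ cofree V}
    (h : ∀ k t, f.app k ≫ cofreeε V k t = g.app k ≫ cofreeε V k t) : f = g := by
  refine hom_ext fun k => cofree_obj_hom_ext fun p => ?_
  induction p with
  | nil t => exact h _ t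
  | cons a p ih =>
    change f.app _ ≫ consπ V a p = g.app _ ≫ consπ V a p
    rw [app_comp_consπ, app_comp_consπ, ih]

/-- The functoriality of the cofree representation. -/
noncomputable def cofreeMap {V' : ∀ k, T k → Φ.obj k} (f : ∀ k t, V k t ⟶ V' k t) :
    cofree V ⟶ cofree V' :=
  cofreeLift fun k t => cofreeε V k t ≫ f k t

@[simp]
lemma cofreeMap_app_ε {V' : ∀ k, T k → Φ.obj k} (f : ∀ k t, V k t ⟶ V' k t) (k : Q) (t : T k) :
    (cofreeMap f).app k ≫ cofreeε V' k t = cofreeε V k t ≫ f k t :=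
  cofreeLift_app_ε _ k t

lemma cofreeMap_app_π {V' : ∀ k, T k → Φ.obj k} (f : ∀ k t, V k t ⟶ V' k t) {k : Q}
    (p : OutPath T k) :
    (cofreeMap f).app k ≫ cofreeπ V' p = cofreeπ V p ≫ pathMap f p := by
  induction p with
  | nil t => exact cofreeMap_app_ε f _ t
  | cons a p ih =>
    change (cofreeMap f).app _ ≫ consπ V' a p = consπ V a p ≫ (Φ.map a).map (pathMap f p)
    rw [app_comp_consπ, ih, Functor.map_comp, ← Category.assoc, cofree_map_comp_map_π]

instance mono_cofreeMap {V' : ∀ k, T k → Φ.obj k} (f : ∀ k t, V k t ⟶ V' k t)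
    [∀ k t, Mono (f k t)] : Mono (cofreeMap f) :=
  ⟨fun g g' e => cofree_hom_ext fun k t => by
    have e' := congrArg (fun m => Hom.app m k ≫ cofreeε V' k t) e
    simp only [comp_app, Category.assoc, cofreeMap_app_ε] at e'
    rwa [← Category.assoc, ← Category.assoc, cancel_mono] at e'⟩

/-- A right adjoint of a functor preserving monomorphisms preserves injectives: extend each
component, then lift. -/
instance injective_cofree [∀ k t, Injective (V k t)] : Injective (cofree V) where
  factors {X X'} g f _ :=
    ⟨cofreeLift fun k t => Injective.factorThru (g.app k ≫ cofreeε V k t) (f.app k), by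
      refine cofree_hom_ext fun k t => ?_
      simp⟩

/-- The inclusion of the summands attached to the paths beginning with a given arrow. -/
noncomputable def cofreeCons {k j : Q} (a : k ⟶ j) :
    (Φ.map a).obj ((cofree V).obj j) ⟶ (cofree V).obj k :=
  ∑ p : OutPath T j, (Φ.map a).map (cofreeπ V p) ≫ consι V a p

lemma cofreeCons_consπ {k j : Q} (a : k ⟶ j) (p : OutPath T j) :
    cofreeCons a ≫ consπ V a p = (Φ.map a).map (cofreeπ V p) := by
  rw [cofreeCons, Preadditive.sum_comp, Finset.sum_eq_single p]
  · rw [Category.assoc, consι_π_self, Category.comp_id]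
  · intro q _ h
    rw [Category.assoc, consι_π_ne a h, comp_zero]
  · simp

lemma map_cofreeι_cons {k j : Q} (a : k ⟶ j) (p : OutPath T j) :
    (Φ.map a).map (cofreeι V p) ≫ cofreeCons a = consι V a p := by
  rw [cofreeCons, Preadditive.comp_sum, Finset.sum_eq_single p]
  · rw [← Category.assoc, ← Functor.map_comp, cofreeι_π_self, CategoryTheory.Functor.map_id,
      Category.id_comp]
  · intro q _ h
    rw [← Category.assoc, ← Functor.map_comp, cofreeι_π_ne h.symm, Functor.map_zero, zero_comp]
  · simp

lemma cofreeCons_π_of_ne {k j : Q} (a : k ⟶ j) (q : OutPath T k)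
    (h : ∀ p, .cons a p ≠ q) : cofreeCons a ≫ cofreeπ V q = 0 := by
  rw [cofreeCons, Preadditive.sum_comp]
  refine Finset.sum_eq_zero fun p _ => ?_
  rw [Category.assoc, consι_cofreeπ_ne a (h p), comp_zero]

@[simp]
lemma cofreeCons_ε {k j : Q} (a : k ⟶ j) (t : T k) :
    cofreeCons a ≫ cofreeε V k t = 0 :=
  cofreeCons_π_of_ne a _ fun _ h => by cases h

-- With `cofreeCons_map_of_ne`: prefixing by `a` is a section of the structure map along `a`, and is
-- killed by those along other arrows.
@[simp]
lemma cofreeCons_map_self {k j : Q} (a : k ⟶ j) :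
    cofreeCons a ≫ (cofree V).map a = 𝟙 _ := by
  refine map_cofree_obj_hom_ext a fun p => ?_
  rw [Category.assoc, cofree_map_comp_map_π, cofreeCons_consπ, Category.id_comp]

lemma cofreeCons_map_of_ne {k j j' : Q} (a : k ⟶ j) (b : k ⟶ j')
    (h : (⟨j, a⟩ : Σ j, (k ⟶ j)) ≠ ⟨j', b⟩) :
    cofreeCons a ≫ (cofree V).map b = 0 := by
  refine map_cofree_obj_hom_ext b fun p => ?_
  rw [Category.assoc, cofree_map_comp_map_π, zero_comp]
  exact cofreeCons_π_of_ne a (.cons b p) fun _ e => h (by cases e; rfl)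

end Cofree

section Exactness

variable [∀ k, Finite (OutPath T k)]

/-- The short complex of cofree representations attached to a family of short complexes. -/
noncomputable abbrev cofreeShortComplex (S : ∀ k, T k → ShortComplex (Φ.obj k)) :
    ShortComplex (DRep Φ) where
  f := cofreeMap fun k t => (S k t).f
  g := cofreeMap fun k t => (S k t).g
  zero := cofree_hom_ext fun k t => by
    rw [comp_app, Category.assoc, cofreeMap_app_ε, ← Category.assoc, cofreeMap_app_ε]
    simp

end Exactness

end DRep

end QuiverDiagram

/-! ### Exactness of the cofree construction and evaluation on `Ext` -/

namespace QuiverDiagram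

namespace DRep

variable {Q : Type u₁} [Quiver.{v₁} Q] {Φ : QuiverDiagram.{v, u} Q} {T : Q → Type t}
  [∀ i, Abelian (Φ.obj i)] [∀ k, Finite (OutPath T k)]

section

variable [Φ.IsExact]

attribute [local instance] Abelian.hasFiniteBiproducts

lemma epi_cofreeMap {V V' : ∀ k, T k → Φ.obj k} (f : ∀ k t, V k t ⟶ V' k t)
    [∀ k t, Epi (f k t)] : Epi (cofreeMap f) := by
  refine epi_of_app _ fun k => ?_
  have (p : OutPath T k) := epi_pathMap f p
  have h : (cofreeMap f).app k = biproduct.map fun p : OutPath T k => pathMap f p := by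
    refine cofree_obj_hom_ext fun p => ?_
    rw [cofreeMap_app_π]
    exact (biproduct.map_π (fun p : OutPath T k => pathMap f p) p).symm
  rw [h]
  exact inferInstanceAs (Epi (biproduct.map fun p : OutPath T k => pathMap f p))

/-- The kernel property is formal, by lifting through the adjunction; only the epimorphism uses
right exactness of the `Φ_a`. -/
lemma shortExact_cofreeShortComplex {S : ∀ k, T k → ShortComplex (Φ.obj k)}
    (hS : ∀ k t, (S k t).ShortExact) : (cofreeShortComplex S).ShortExact := by
  have := fun k t => (hS k t).mono_f
  have := fun k t => (hS k t).epi_g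
  have hf : Mono (cofreeShortComplex S).f := mono_cofreeMap fun k t => (S k t).f
  have hg : Epi (cofreeShortComplex S).g := epi_cofreeMap fun k t => (S k t).g
  refine { exact := ShortComplex.exact_of_f_is_kernel _ (KernelFork.IsLimit.ofι' _ _
    fun {Z} g h => ⟨cofreeLift fun k t => (hS k t).exact.lift (g.app k ≫ cofreeε _ k t) ?_, ?_⟩) }
  · have h' := congrArg (fun m => Hom.app m k ≫ cofreeε _ k t) h
    rw [Category.assoc, ← cofreeMap_app_ε (fun k t => (S k t).g), ← Category.assoc]
    exact h'.trans zero_comp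
  · refine cofree_hom_ext fun k t => ?_
    rw [comp_app, Category.assoc, cofreeMap_app_ε, ← Category.assoc, cofreeLift_app_ε, ShortComplex.Exact.lift_f]

end

section Eval

variable [Φ.IsLeftExact] [∀ i, HasExt.{w} (Φ.obj i)]

/-- The component at a vertex of a short complex of representations. -/
abbrev evalShortComplex (S : ShortComplex (DRep Φ)) (k : Q) : ShortComplex (Φ.obj k) where
  f := S.f.app k
  g := S.g.app k
  zero := congrArg (fun m => Hom.app m k) S.zero

lemma shortExact_evalShortComplex {S : ShortComplex (DRep Φ)} (hS : S.ShortExact) (k : Q) :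
    (evalShortComplex S k).ShortExact :=
  hS.map_of_exact (eval Φ k)

/-- The map `Extⁿ(X, Y) → Extⁿ(X_k, Y_k)`. -/
noncomputable def extEval {X Y : DRep Φ} {n : ℕ} (e : Ext.{max u₁ v₁ u v} X Y n) (k : Q) :
    Ext.{w} (X.obj k) (Y.obj k) n :=
  e.mapExactFunctor (eval Φ k)

lemma extEval_mk₀ {X Y : DRep Φ} (f : X ⟶ Y) (k : Q) :
    extEval.{w} (Ext.mk₀ f) k = Ext.mk₀ (f.app k) :=
  Ext.mapExactFunctor_mk₀ _ _

lemma extEval_comp {X Y Z : DRep Φ} {a b c : ℕ} (x : Ext.{max u₁ v₁ u v} X Y a)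
    (y : Ext.{max u₁ v₁ u v} Y Z b) (h : a + b = c) (k : Q) :
    extEval.{w} (x.comp y h) k = (extEval.{w} x k).comp (extEval.{w} y k) h :=
  Ext.mapExactFunctor_comp _ _ _ _

lemma extEval_extClass {S : ShortComplex (DRep Φ)} (hS : S.ShortExact) (k : Q) :
    extEval.{w} hS.extClass k = (shortExact_evalShortComplex hS k).extClass :=
  Ext.mapExactFunctor_extClass _ _

end Eval

/-! ### `Ext` into a cofree representation -/

section Comparison

variable [Φ.IsExact] [∀ i, HasExt.{w} (Φ.obj i)]

/-- The map `Extⁿ(X, C) → ∏ Extⁿ(X_k, V_{k, t})`, where `C` is the cofree representation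
on the family `V`. -/
noncomputable def extCofree (X : DRep Φ) (V : ∀ k, T k → Φ.obj k) (n : ℕ) :
    Ext.{max u₁ v₁ u v} X (cofree V) n →+ ∀ k t, Ext.{w} (X.obj k) (V k t) n :=
  AddMonoidHom.pi fun k => AddMonoidHom.pi fun t =>
    (Ext.postcomp (Ext.mk₀ (cofreeε V k t)) (X.obj k) (add_zero n)).comp
      ((eval Φ k).mapExtAddHom X (cofree V) n)

lemma extCofree_apply {X : DRep Φ} {V : ∀ k, T k → Φ.obj k} {n : ℕ}
    (e : Ext.{max u₁ v₁ u v} X (cofree V) n) (k : Q) (t : T k) :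
    extCofree.{w} X V n e k t =
      (extEval.{w} e k).comp (Ext.mk₀ (cofreeε V k t)) (add_zero n) := rfl

lemma extCofree_mk₀ {X : DRep Φ} {V : ∀ k, T k → Φ.obj k} (f : X ⟶ cofree V) (k : Q) (t : T k) :
    extCofree.{w} X V 0 (Ext.mk₀ f) k t = Ext.mk₀ (f.app k ≫ cofreeε V k t) := by
  rw [extCofree_apply, extEval_mk₀, Ext.mk₀_comp_mk₀]

lemma extCofree_comp_mk₀ {X Y : DRep Φ} {V : ∀ k, T k → Φ.obj k} (f : Y ⟶ cofree V) {n : ℕ}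
    (e : Ext.{max u₁ v₁ u v} X Y n) (k : Q) (t : T k) :
    extCofree.{w} X V n (e.comp (Ext.mk₀ f) (add_zero n)) k t =
      (extEval.{w} e k).comp (Ext.mk₀ (f.app k ≫ cofreeε V k t)) (add_zero n) := by
  rw [extCofree_apply, extEval_comp, extEval_mk₀, Ext.comp_assoc_of_third_deg_zero,
    Ext.mk₀_comp_mk₀]

lemma extCofree_comp_cofreeMap {X : DRep Φ} {V V' : ∀ k, T k → Φ.obj k}
    (f : ∀ k t, V k t ⟶ V' k t) {n : ℕ} (e : Ext.{max u₁ v₁ u v} X (cofree V) n)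
    (k : Q) (t : T k) :
    extCofree.{w} X V' n (e.comp (Ext.mk₀ (cofreeMap f)) (add_zero n)) k t =
      (extCofree.{w} X V n e k t).comp (Ext.mk₀ (f k t)) (add_zero n) := by
  rw [extCofree_comp_mk₀, extCofree_apply, Ext.comp_assoc_of_third_deg_zero, Ext.mk₀_comp_mk₀,
    cofreeMap_app_ε]

lemma extCofree_comp_extClass {X : DRep Φ} {S : ∀ k, T k → ShortComplex (Φ.obj k)}
    (hS : ∀ k t, (S k t).ShortExact) {n : ℕ}
    (e : Ext.{max u₁ v₁ u v} X (cofree fun k t => (S k t).X₃) n) (k : Q) (t : T k) :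
    extCofree.{w} X (fun k t => (S k t).X₁) (n + 1)
        (e.comp (shortExact_cofreeShortComplex hS).extClass rfl) k t =
      (extCofree.{w} X _ n e k t).comp (hS k t).extClass rfl := by
  -- The counits form a morphism of short exact sequences, and extension classes are natural.
  let φ : evalShortComplex (cofreeShortComplex S) k ⟶ S k t :=
    { τ₁ := cofreeε (fun k t => (S k t).X₁) k t
      τ₂ := cofreeε (fun k t => (S k t).X₂) k t
      τ₃ := cofreeε (fun k t => (S k t).X₃) k t
      comm₁₂ := (cofreeMap_app_ε (fun k t => (S k t).f) k t).symm
      comm₂₃ := (cofreeMap_app_ε (fun k t => (S k t).g) k t).symm }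
  have h := ShortComplex.ShortExact.extClass_naturality
    (shortExact_evalShortComplex (shortExact_cofreeShortComplex hS) k) (hS k t) φ
  rw [extCofree_apply, extCofree_apply, extEval_comp, extEval_extClass,
    Ext.comp_assoc_of_third_deg_zero, Ext.comp_assoc_of_second_deg_zero]
  exact congrArg (fun x => Ext.comp (extEval.{w} e k) x rfl) h

lemma extCofree_bijective_zero (X : DRep Φ) (V : ∀ k, T k → Φ.obj k) :
    Function.Bijective (extCofree.{w} X V 0) := by
  constructor
  · intro x y e
    obtain ⟨f, rfl⟩ := (Ext.mk₀_bijective _ _).2 x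
    obtain ⟨g, rfl⟩ := (Ext.mk₀_bijective _ _).2 y
    congr 1
    refine cofree_hom_ext fun k t => (Ext.mk₀_bijective _ _).1 ?_
    rw [← extCofree_mk₀, ← extCofree_mk₀, e]
  · intro x
    choose f hf using fun k t => (Ext.mk₀_bijective _ _).2 (x k t)
    refine ⟨Ext.mk₀ (cofreeLift f), ?_⟩
    ext k t
    rw [extCofree_mk₀, cofreeLift_app_ε, hf]

/-- Dimension shifting: both middle terms are injective, so on either side degree `n + 1` at `X₁` is
the cokernel of the degree `n` map from `X₂` to `X₃`. Surjectivity at `X₂` suffices to compare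
cokernels. -/
lemma extCofree_bijective_succ (X : DRep Φ) {S : ∀ k, T k → ShortComplex (Φ.obj k)}
    (hS : ∀ k t, (S k t).ShortExact) [∀ k t, Injective (S k t).X₂] {n : ℕ}
    (h₂ : Function.Surjective (extCofree.{w} X (fun k t => (S k t).X₂) n))
    (h₃ : Function.Bijective (extCofree.{w} X (fun k t => (S k t).X₃) n)) :
    Function.Bijective (extCofree.{w} X (fun k t => (S k t).X₁) (n + 1)) := by
  have hC := shortExact_cofreeShortComplex hS
  have : Injective (cofree fun k t => (S k t).X₂) := injective_cofree
  constructor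
  · refine (injective_iff_map_eq_zero _).2 fun x hx => ?_
    obtain ⟨y, rfl⟩ := Ext.covariant_sequence_exact₁ X hC x (Ext.eq_zero_of_injective _) rfl
    have hy (k : Q) (t : T k) :
        (extCofree.{w} X (fun k t => (S k t).X₃) n y k t).comp (hS k t).extClass rfl = 0 := by
      rw [← extCofree_comp_extClass hS]
      exact congrFun (congrFun hx k) t
    -- The components of `y` lift to `X₂`; `h₂` realises the lifts by one class, whose image is `y`
    -- by injectivity in `h₃`.
    choose z hz using fun k t => Ext.covariant_sequence_exact₃ _ (hS k t) _ rfl (hy k t)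
    obtain ⟨z', rfl⟩ := h₂ z
    have : y = z'.comp (Ext.mk₀ (cofreeMap fun k t => (S k t).g)) (add_zero n) := by
      refine h₃.1 (funext fun k => funext fun t => ?_)
      rw [← hz, extCofree_comp_cofreeMap]
    rw [this, Ext.comp_assoc_of_second_deg_zero]
    erw [hC.comp_extClass]
    rw [Ext.comp_zero]
  · intro x
    choose y hy using fun k t =>
      Ext.covariant_sequence_exact₁ _ (hS k t) (x k t) (Ext.eq_zero_of_injective _) rfl
    obtain ⟨z, rfl⟩ := h₃.2 y
    refine ⟨z.comp hC.extClass rfl, funext fun k => funext fun t => ?_⟩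
    rw [← hy, extCofree_comp_extClass hS]

lemma extCofree_bijective [∀ i, EnoughInjectives (Φ.obj i)] (X : DRep Φ)
    (V : ∀ k, T k → Φ.obj k) (n : ℕ) : Function.Bijective (extCofree.{w} X V n) := by
  induction n generalizing V with
  | zero => exact extCofree_bijective_zero X V
  | succ n ih =>
    let S (k : Q) (t : T k) : ShortComplex (Φ.obj k) :=
      ShortComplex.mk (Injective.ι (V k t)) (cokernel.π _) (cokernel.condition _)
    have hS (k : Q) (t : T k) : (S k t).ShortExact :=
      { exact := ShortComplex.exact_of_g_is_cokernel _ (cokernelIsCokernel _)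
        mono_f := inferInstanceAs (Mono (Injective.ι (V k t)))
        epi_g := inferInstanceAs (Epi (cokernel.π (Injective.ι (V k t)))) }
    have : ∀ k t, Injective (S k t).X₂ := fun k t =>
      inferInstanceAs (Injective (Injective.under (V k t)))
    exact extCofree_bijective_succ X hS (ih _).2 (ih _)

end Comparison

end DRep

end QuiverDiagram

/-! ### Enough injectives and compatibility of extension classes with structure maps -/

namespace QuiverDiagram

namespace DRep

variable {Q : Type u₁} [Quiver.{v₁} Q] {Φ : QuiverDiagram.{v, u} Q} [∀ i, Abelian (Φ.obj i)]

/-- Embed each `Y_k` in an injective; the adjoint morphism to the cofree representation is mono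
because its composite with the counit is. -/
lemma enoughInjectives [Φ.IsLeftExact] [∀ k, Finite (OutPath (fun _ : Q => Unit) k)]
    [∀ i, EnoughInjectives (Φ.obj i)] : EnoughInjectives (DRep Φ) where
  presentation Y :=
    ⟨{ J := cofree fun (k : Q) (_ : Unit) => Injective.under (Y.obj k)
       injective := injective_cofree
       f := cofreeLift fun k _ => Injective.ι (Y.obj k)
       mono := mono_of_app _ fun k =>
        have h := cofreeLift_app_ε (X := Y) (fun k (_ : Unit) => Injective.ι (Y.obj k)) k ()
        have : Mono ((cofreeLift (X := Y) fun k (_ : Unit) => Injective.ι (Y.obj k)).app k ≫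
          cofreeε (fun (k : Q) (_ : Unit) => Injective.under (Y.obj k)) k ()) := by
          rw [h]
          infer_instance
        mono_of_mono _ (cofreeε _ k ()) }⟩

section Naturality

variable [Φ.IsExact] [∀ i, HasExt.{w} (Φ.obj i)]

lemma extClass_comp_map {S : ShortComplex (DRep Φ)} (hS : S.ShortExact) {k j : Q} (a : k ⟶ j) :
    (shortExact_evalShortComplex hS k).extClass.comp (Ext.mk₀.{w} (S.X₁.map a)) (add_zero 1) =
      (Ext.mk₀ (S.X₃.map a)).comp
        ((shortExact_evalShortComplex hS j).extClass.mapExactFunctor (Φ.map a)) (zero_add 1) := by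
  -- The structure maps along `a` of the three terms form a morphism of short exact sequences.
  let φ : evalShortComplex S k ⟶ (evalShortComplex S j).map (Φ.map a) :=
    { τ₁ := S.X₁.map a
      τ₂ := S.X₂.map a
      τ₃ := S.X₃.map a
      comm₁₂ := (S.f.comm a).symm
      comm₂₃ := (S.g.comm a).symm }
  rw [Ext.mapExactFunctor_extClass]
  exact ShortComplex.ShortExact.extClass_naturality _
    ((shortExact_evalShortComplex hS j).map_of_exact (Φ.map a)) φ

/-- The compatibility of the components of an extension class of representations. -/
lemma extEval_comp_map [EnoughInjectives (DRep Φ)] {X Y : DRep Φ} {n : ℕ}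
    (e : Ext.{max u₁ v₁ u v} X Y n) {k j : Q} (a : k ⟶ j) :
    (extEval.{w} e k).comp (Ext.mk₀ (Y.map a)) (add_zero n) =
      (Ext.mk₀ (X.map a)).comp ((extEval.{w} e j).mapExactFunctor (Φ.map a)) (zero_add n) := by
  induction n generalizing Y with
  | zero =>
    obtain ⟨f, rfl⟩ := (Ext.mk₀_bijective _ _).2 e
    rw [extEval_mk₀, extEval_mk₀, Ext.mapExactFunctor_mk₀, Ext.mk₀_comp_mk₀, Ext.mk₀_comp_mk₀,
      f.comm]
  | succ n ih =>
    let S : ShortComplex (DRep Φ) :=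
      ShortComplex.mk (Injective.ι Y) (cokernel.π _) (cokernel.condition _)
    have hS : S.ShortExact :=
      { exact := ShortComplex.exact_of_g_is_cokernel _ (cokernelIsCokernel _)
        mono_f := inferInstanceAs (Mono (Injective.ι Y))
        epi_g := inferInstanceAs (Epi (cokernel.π (Injective.ι Y))) }
    have : Injective S.X₂ := inferInstanceAs (Injective (Injective.under Y))
    -- Factor `e` as a degree `n` class followed by an extension class: `extClass_comp_map` handles
    -- the latter, induction the former.
    obtain ⟨y, rfl⟩ := Ext.covariant_sequence_exact₁ X hS e (Ext.eq_zero_of_injective _) rfl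
    have h := extClass_comp_map.{w} hS a
    rw [extEval_comp, extEval_comp, extEval_extClass, extEval_extClass, Ext.mapExactFunctor_comp,
      Ext.comp_assoc_of_third_deg_zero]
    refine (congrArg (fun x => Ext.comp (extEval.{w} y k) x rfl) h).trans ?_
    rw [← Ext.comp_assoc_of_second_deg_zero, ih, Ext.comp_assoc _ _ _ (zero_add n) rfl (by lia)]

end Naturality

/-! ### The two-term cofree coresolution -/

section Resolution

variable [Φ.IsLeftExact] [∀ k, Finite (OutPath (fun _ : Q => Unit) k)]
  [∀ k, Finite (OutPath (fun k : Q => Σ j, (k ⟶ j)) k)]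

/-- The first term of the coresolution of a representation by cofree representations. -/
noncomputable abbrev cofreeVertex (Y : DRep Φ) : DRep Φ :=
  cofree (T := fun _ : Q => Unit) fun k _ => Y.obj k

/-- The second term of the coresolution of a representation by cofree representations. -/
noncomputable abbrev cofreeArrow (Y : DRep Φ) : DRep Φ :=
  cofree (T := fun k : Q => Σ j, (k ⟶ j)) fun _ a => (Φ.map a.2).obj (Y.obj a.1)

/-- The projection of `cofreeVertex Y` on `Y` at a vertex. -/
noncomputable abbrev vertexε (Y : DRep Φ) (k : Q) : (cofreeVertex Y).obj k ⟶ Y.obj k :=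
  cofreeε (T := fun _ : Q => Unit) (fun k _ => Y.obj k) k ()

/-- The projection of `cofreeArrow Y` on the term attached to an arrow. -/
noncomputable abbrev arrowε (Y : DRep Φ) {k j : Q} (a : k ⟶ j) :
    (cofreeArrow Y).obj k ⟶ (Φ.map a).obj (Y.obj j) :=
  cofreeε (T := fun k : Q => Σ j, (k ⟶ j)) (fun _ a => (Φ.map a.2).obj (Y.obj a.1)) k ⟨j, a⟩

/-- The unit `Y ⟶ cofreeVertex Y`. -/
noncomputable def vertexη (Y : DRep Φ) : Y ⟶ cofreeVertex Y :=
  cofreeLift fun k _ => 𝟙 (Y.obj k)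

/-- The differential `cofreeVertex Y ⟶ cofreeArrow Y`. -/
noncomputable def vertexToArrow (Y : DRep Φ) : cofreeVertex Y ⟶ cofreeArrow Y :=
  cofreeLift fun k a =>
    (cofreeVertex Y).map a.2 ≫ (Φ.map a.2).map (vertexε Y a.1) - vertexε Y k ≫ Y.map a.2

variable (Y : DRep Φ)

lemma vertexη_app_ε (k : Q) : (vertexη Y).app k ≫ vertexε Y k = 𝟙 (Y.obj k) :=
  cofreeLift_app_ε (fun k (_ : Unit) => 𝟙 (Y.obj k)) k ()

lemma vertexToArrow_app_ε {k j : Q} (a : k ⟶ j) :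
    (vertexToArrow Y).app k ≫ arrowε Y a =
      (cofreeVertex Y).map a ≫ (Φ.map a).map (vertexε Y j) - vertexε Y k ≫ Y.map a :=
  cofreeLift_app_ε (V := fun _ (a : Σ j, (_ ⟶ j)) => (Φ.map a.2).obj (Y.obj a.1)) _ k ⟨j, a⟩

-- Under the adjunctions the differential measures how far a family `X_k ⟶ Y_k` is from a morphism
-- of representations.
variable {Y} in
lemma app_vertexToArrow_app_ε {X : DRep Φ} (f : X ⟶ cofreeVertex Y) {k j : Q} (a : k ⟶ j) :
    (f ≫ vertexToArrow Y).app k ≫ arrowε Y a =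
      X.map a ≫ (Φ.map a).map (f.app j ≫ vertexε Y j) - (f.app k ≫ vertexε Y k) ≫ Y.map a := by
  rw [comp_app, Category.assoc, vertexToArrow_app_ε, Preadditive.comp_sub, f.comm_assoc,
    Functor.map_comp, Category.assoc]

lemma vertexη_vertexToArrow : vertexη Y ≫ vertexToArrow Y = 0 := by
  refine cofree_hom_ext fun k a => ?_
  refine (app_vertexToArrow_app_ε (vertexη Y) a.2).trans ?_
  rw [vertexη_app_ε, vertexη_app_ε, CategoryTheory.Functor.map_id, Category.comp_id,
    Category.id_comp, sub_self, zero_app, zero_comp]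

instance : Mono (vertexη Y) :=
  mono_of_app _ fun k =>
    have : Mono ((vertexη Y).app k ≫ vertexε Y k) := by
      rw [vertexη_app_ε]
      infer_instance
    mono_of_mono _ (vertexε Y k)

/-- The inclusion in `cofreeArrow Y` of the term attached to an arrow. -/
noncomputable def arrowι {k j : Q} (a : k ⟶ j) :
    (Φ.map a).obj (Y.obj j) ⟶ (cofreeArrow Y).obj k :=
  cofreeι (T := fun k : Q => Σ j, (k ⟶ j)) (fun _ a => (Φ.map a.2).obj (Y.obj a.1))
    (.nil ⟨j, a⟩)

lemma arrowι_ε {k j : Q} (a : k ⟶ j) : arrowι Y a ≫ arrowε Y a = 𝟙 _ :=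
  cofreeι_π_self _

lemma arrowι_ε_of_ne {k j j' : Q} (a : k ⟶ j) (b : k ⟶ j')
    (h : (⟨j, a⟩ : Σ j, (k ⟶ j)) ≠ ⟨j', b⟩) : arrowι Y a ≫ arrowε Y b = 0 :=
  cofreeι_π_ne fun e => h (by cases e; rfl)

lemma arrowι_consπ {k j j' : Q} (a : k ⟶ j) (b : k ⟶ j')
    (q : OutPath (fun k : Q => Σ j, (k ⟶ j)) j') :
    arrowι Y a ≫ consπ (fun _ a => (Φ.map a.2).obj (Y.obj a.1)) b q = 0 :=
  cofreeι_π_ne fun e => by cases e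

/-- Prefixing by `a` commutes with the differential up to a term at the one-arrow path `a`. This is
the recursion that produces preimages under the differential. -/
lemma map_cofreeCons_vertexToArrow {k j : Q} (a : k ⟶ j) {W : Φ.obj j}
    (m : W ⟶ (cofreeVertex Y).obj j) :
    ((Φ.map a).map m ≫ cofreeCons a) ≫ (vertexToArrow Y).app k =
      (Φ.map a).map (m ≫ vertexε Y j) ≫ arrowι Y a +
        (Φ.map a).map (m ≫ (vertexToArrow Y).app j) ≫ cofreeCons a := by
  refine cofree_obj_hom_ext ?_
  -- At a trivial path the definition of the differential applies; at a longer one, its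
  -- compatibility with structure maps.
  rintro (⟨j', b⟩ | ⟨b, q⟩)
  · change (_ ≫ (vertexToArrow Y).app k) ≫ arrowε Y b = _ ≫ arrowε Y b
    rw [Category.assoc, vertexToArrow_app_ε, Preadditive.comp_sub, Preadditive.add_comp,
      Category.assoc, Category.assoc, Category.assoc, Category.assoc, cofreeCons_ε, comp_zero,
      add_zero, ← Category.assoc (cofreeCons a) (vertexε Y k), cofreeCons_ε, zero_comp, comp_zero,
      sub_zero, ← Category.assoc (cofreeCons a)]
    by_cases h : (⟨j, a⟩ : Σ j, (k ⟶ j)) = ⟨j', b⟩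
    · cases h
      rw [cofreeCons_map_self, arrowι_ε, Category.id_comp, Category.comp_id, Functor.map_comp]
    · rw [cofreeCons_map_of_ne a b h, arrowι_ε_of_ne Y a b h, zero_comp, comp_zero, comp_zero]
  · rename_i j'
    change (_ ≫ (vertexToArrow Y).app k) ≫ consπ _ b q = _ ≫ consπ _ b q
    rw [Category.assoc, app_comp_consπ, Preadditive.add_comp, Category.assoc, Category.assoc,
      Category.assoc, arrowι_consπ, comp_zero, zero_add, ← cofree_map_comp_map_π,
      ← Category.assoc (cofreeCons a), ← Category.assoc (cofreeCons a)]
    by_cases h : (⟨j, a⟩ : Σ j, (k ⟶ j)) = ⟨j', b⟩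
    · cases h
      rw [cofreeCons_map_self, cofreeCons_map_self, Category.id_comp, Category.id_comp,
        ← Functor.map_comp, ← Functor.map_comp, Category.assoc]
    · rw [cofreeCons_map_of_ne a b h, cofreeCons_map_of_ne a b h, zero_comp, zero_comp, comp_zero,
        comp_zero]

lemma map_cofreeCons_vertexε {k j : Q} (a : k ⟶ j) {W : Φ.obj j}
    (m : W ⟶ (cofreeVertex Y).obj j) :
    ((Φ.map a).map m ≫ cofreeCons a) ≫ vertexε Y k = 0 := by
  rw [Category.assoc, cofreeCons_ε, comp_zero]

/-- The vanishing of `s ≫ vertexε Y k` is carried along because it kills the correction term of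
`map_cofreeCons_vertexToArrow` at the next arrow. -/
lemma exists_section_vertexToArrow {k : Q}
    (p : OutPath (fun k : Q => Σ j, (k ⟶ j)) k) :
    ∃ s : pathObj (fun _ a => (Φ.map a.2).obj (Y.obj a.1)) p ⟶ (cofreeVertex Y).obj k,
      s ≫ vertexε Y k = 0 ∧ s ≫ (vertexToArrow Y).app k = cofreeι _ p := by
  induction p with
  | nil a =>
    -- The unit is killed by the differential and split by `vertexε`, so only the correction term
    -- survives.
    refine ⟨(Φ.map a.2).map ((vertexη Y).app a.1) ≫ cofreeCons a.2, ?_, ?_⟩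
    · exact map_cofreeCons_vertexε Y _ _
    · have h : (vertexη Y).app a.1 ≫ (vertexToArrow Y).app a.1 = 0 :=
        congrArg (fun m => Hom.app m a.1) (vertexη_vertexToArrow Y)
      have h' := map_cofreeCons_vertexToArrow Y a.2 ((vertexη Y).app a.1)
      rw [h, vertexη_app_ε, CategoryTheory.Functor.map_id, Category.id_comp, Functor.map_zero,
        zero_comp, add_zero] at h'
      exact h'
  | cons a p ih =>
    obtain ⟨s, hs, hs'⟩ := ih
    refine ⟨(Φ.map a).map s ≫ cofreeCons a, ?_, ?_⟩
    · exact map_cofreeCons_vertexε Y _ _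
    · have h' := map_cofreeCons_vertexToArrow Y a s
      rw [hs, hs', Functor.map_zero, zero_comp, zero_add, map_cofreeι_cons] at h'
      exact h'

instance : Epi (vertexToArrow Y) := epi_of_app _ fun k => ⟨fun u u' e =>
  cofree_obj_hom_ext' fun p => by
    obtain ⟨s, -, hs⟩ := exists_section_vertexToArrow Y p
    rw [← hs, Category.assoc, e, Category.assoc]⟩

/-- The coresolution of a representation by cofree representations. -/
noncomputable abbrev cofreeResolution : ShortComplex (DRep Φ) :=
  ShortComplex.mk (vertexη Y) (vertexToArrow Y) (vertexη_vertexToArrow Y)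

/-- For `g` killed by the differential, the components `g.app k ≫ vertexε Y k` commute with the
structure maps, so `g` factors through `Y`. -/
lemma shortExact_cofreeResolution : (cofreeResolution Y).ShortExact where
  exact := ShortComplex.exact_of_f_is_kernel _ (KernelFork.IsLimit.ofι' _ _ fun {Z} g h =>
    ⟨{ app := fun k => g.app k ≫ vertexε Y k
       comm := fun {k j} a => by
        have h' := app_vertexToArrow_app_ε g a
        rw [h, zero_app, zero_comp] at h'
        exact (sub_eq_zero.1 h'.symm).symm },
      cofree_hom_ext fun k _ => by
        rw [comp_app, Category.assoc]
        erw [vertexη_app_ε]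
        exact Category.comp_id _⟩)

end Resolution

/-! ### The long exact sequence and its maps -/

section Sequence

variable [Φ.IsExact] [∀ k, Finite (OutPath (fun _ : Q => Unit) k)]
  [∀ k, Finite (OutPath (fun k : Q => Σ j, (k ⟶ j)) k)]
  [∀ i, IsGrothendieckAbelian.{w} (Φ.obj i)] (X Y : DRep Φ) (n : ℕ)

/-- The isomorphism `Extⁿ(X, cofreeVertex Y) ≃ ∏_i Extⁿ(X_i, Y_i)`. -/
noncomputable def extVertexEquiv :
    Ext.{max u₁ v₁ u v} X (cofreeVertex Y) n ≃+ ∀ i : Q, Ext.{w} (X.obj i) (Y.obj i) n :=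
  AddEquiv.ofBijective
    (AddMonoidHom.pi fun i => (Pi.evalAddMonoidHom _ ()).comp
      ((Pi.evalAddMonoidHom _ i).comp (extCofree.{w} X (fun i (_ : Unit) => Y.obj i) n))) <| by
    obtain ⟨h, h'⟩ := extCofree_bijective.{w} X (fun i (_ : Unit) => Y.obj i) n
    refine ⟨fun x y e => h (funext fun i => funext fun _ => congrFun e i), fun x => ?_⟩
    obtain ⟨y, hy⟩ := h' fun i _ => x i
    exact ⟨y, funext fun i => congrFun (congrFun hy i) ()⟩

/-- The isomorphism `Extⁿ(X, cofreeArrow Y) ≃ ∏_{a : i ⟶ j} Extⁿ(X_i, Φ_a Y_j)`. -/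
noncomputable def extArrowEquiv :
    Ext.{max u₁ v₁ u v} X (cofreeArrow Y) n ≃+
      ∀ a : Quiver.Total Q, Ext.{w} (X.obj a.left) ((Φ.map a.hom).obj (Y.obj a.right)) n :=
  AddEquiv.ofBijective
    (AddMonoidHom.pi fun a => (Pi.evalAddMonoidHom _ (⟨a.right, a.hom⟩ : Σ j, (a.left ⟶ j))).comp
      ((Pi.evalAddMonoidHom _ a.left).comp (extCofree.{w} X
        (fun k (a : Σ j, (k ⟶ j)) => (Φ.map a.2).obj (Y.obj a.1)) n))) <| by
    obtain ⟨h, h'⟩ := extCofree_bijective.{w} X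
      (fun k (a : Σ j, (k ⟶ j)) => (Φ.map a.2).obj (Y.obj a.1)) n
    refine ⟨fun x y e => h (funext fun i => funext fun a =>
      congrFun e (⟨i, a.1, a.2⟩ : Quiver.Total Q)), fun x => ?_⟩
    obtain ⟨y, hy⟩ := h' fun i a => x ⟨i, a.1, a.2⟩
    exact ⟨y, funext fun a => congrFun (congrFun hy a.left) ⟨a.right, a.hom⟩⟩

variable {X Y n}

lemma extVertexEquiv_apply (e : Ext.{max u₁ v₁ u v} X (cofreeVertex Y) n) (i : Q) :
    extVertexEquiv.{w} X Y n e i =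
      (extEval.{w} e i).comp (Ext.mk₀ (vertexε Y i)) (add_zero n) := rfl

lemma extArrowEquiv_apply (e : Ext.{max u₁ v₁ u v} X (cofreeArrow Y) n) (a : Quiver.Total Q) :
    extArrowEquiv.{w} X Y n e a =
      (extEval.{w} e a.left).comp (Ext.mk₀ (arrowε Y a.hom)) (add_zero n) := rfl

lemma extRestrict_apply (e : Ext.{max u₁ v₁ u v} X Y n) (i : Q) :
    extRestrict.{w} X Y n e i = extEval.{w} e i := rfl

lemma extDiff_apply (e : ∀ i : Q, Ext.{w} (X.obj i) (Y.obj i) n) (a : Quiver.Total Q) :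
    extDiff.{w} X Y n e a =
      (Ext.mk₀ (X.map a.hom)).comp ((e a.right).mapExactFunctor (Φ.map a.hom)) (zero_add n) -
        (e a.left).comp (Ext.mk₀ (Y.map a.hom)) (add_zero n) := rfl

/-- The triangle identity: the unit followed by the counit is the identity of `Y_i`. -/
lemma extVertexEquiv_comp_vertexη (e : Ext.{max u₁ v₁ u v} X Y n) :
    extVertexEquiv.{w} X Y n (e.comp (Ext.mk₀ (vertexη Y)) (add_zero n)) =
      extRestrict.{w} X Y n e := by
  funext i
  rw [extVertexEquiv_apply, extEval_comp, extEval_mk₀, Ext.comp_assoc_of_third_deg_zero,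
    Ext.mk₀_comp_mk₀, vertexη_app_ε, Ext.comp_mk₀_id, extRestrict_apply]

/-- The differential involves the structure map of `cofreeVertex Y`; `extEval_comp_map` trades it
for that of `X`, giving the first term of `extDiff`. -/
lemma extArrowEquiv_comp_vertexToArrow (e : Ext.{max u₁ v₁ u v} X (cofreeVertex Y) n) :
    extArrowEquiv.{w} X Y n (e.comp (Ext.mk₀ (vertexToArrow Y)) (add_zero n)) =
      extDiff.{w} X Y n (extVertexEquiv.{w} X Y n e) := by
  have := enoughInjectives (Φ := Φ)
  funext a
  rw [extArrowEquiv_apply, extEval_comp, extEval_mk₀, Ext.comp_assoc_of_third_deg_zero,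
    Ext.mk₀_comp_mk₀, vertexToArrow_app_ε, extDiff_apply, extVertexEquiv_apply,
    extVertexEquiv_apply, sub_eq_add_neg, Ext.mk₀_add, Ext.comp_add, Ext.mk₀_neg, Ext.comp_neg,
    ← sub_eq_add_neg, Ext.comp_assoc_of_third_deg_zero, Ext.mk₀_comp_mk₀,
    Ext.mapExactFunctor_comp, Ext.mapExactFunctor_mk₀, ← Ext.mk₀_comp_mk₀,
    ← Ext.comp_assoc_of_third_deg_zero, extEval_comp_map, Ext.comp_assoc_of_third_deg_zero]

variable (X Y n)

/-- The connecting homomorphism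
`∏_{a : i ⟶ j} Extⁿ(X_i, Φ_a Y_j) → Extⁿ⁺¹(X, Y)`. -/
noncomputable def extConnecting :
    (∀ a : Quiver.Total Q, Ext.{w} (X.obj a.left) ((Φ.map a.hom).obj (Y.obj a.right)) n) →+
      Ext.{max u₁ v₁ u v} X Y (n + 1) :=
  ((shortExact_cofreeResolution Y).extClass.postcomp X rfl).comp
    (extArrowEquiv.{w} X Y n).symm.toAddMonoidHom

lemma exact_extRestrict_extDiff :
    Function.Exact (extRestrict.{w} X Y n) (extDiff.{w} X Y n) := by
  have h := Ext.covariant_sequence_exact₂' X (shortExact_cofreeResolution Y) n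
  rw [ShortComplex.ab_exact_iff_function_exact] at h
  refine Function.Exact.of_ladder_addEquiv_of_exact (e₁ := AddEquiv.refl _)
    (e₂ := extVertexEquiv.{w} X Y n) (e₃ := extArrowEquiv.{w} X Y n) ?_ ?_ h
  · ext1 x
    exact (extVertexEquiv_comp_vertexη x).symm
  · ext1 x
    exact (extArrowEquiv_comp_vertexToArrow x).symm

lemma exact_extDiff_extConnecting :
    Function.Exact (extDiff.{w} X Y n) (extConnecting.{w} X Y n) := by
  have h := Ext.covariant_sequence_exact₃' X (shortExact_cofreeResolution Y) n (n + 1) rfl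
  rw [ShortComplex.ab_exact_iff_function_exact] at h
  refine Function.Exact.of_ladder_addEquiv_of_exact (e₁ := extVertexEquiv.{w} X Y n)
    (e₂ := extArrowEquiv.{w} X Y n) (e₃ := AddEquiv.refl _) ?_ ?_ h
  · ext1 x
    exact (extArrowEquiv_comp_vertexToArrow x).symm
  · ext1 x
    exact congrArg (fun y => y.comp (shortExact_cofreeResolution Y).extClass rfl)
      ((extArrowEquiv.{w} X Y n).symm_apply_apply x)

lemma exact_extConnecting_extRestrict :
    Function.Exact (extConnecting.{w} X Y n) (extRestrict.{w} X Y (n + 1)) := by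
  have h := Ext.covariant_sequence_exact₁' X (shortExact_cofreeResolution Y) n (n + 1) rfl
  rw [ShortComplex.ab_exact_iff_function_exact] at h
  refine Function.Exact.of_ladder_addEquiv_of_exact (e₁ := extArrowEquiv.{w} X Y n)
    (e₂ := AddEquiv.refl _) (e₃ := extVertexEquiv.{w} X Y (n + 1)) ?_ ?_ h
  · ext1 x
    exact congrArg (fun y => y.comp (shortExact_cofreeResolution Y).extClass rfl)
      ((extArrowEquiv.{w} X Y n).symm_apply_apply x)
  · ext1 x
    exact (extVertexEquiv_comp_vertexη x).symm

end Sequence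

/-! ### Degree zero: from `Ext⁰` to morphisms -/

section Hom

variable (X Y : DRep Φ)

lemma homRestrict_injective [Φ.IsLeftExact] : Function.Injective (homRestrict X Y) :=
  fun _ _ h => Hom.ext h

lemma exact_homRestrict_homDiff [Φ.IsLeftExact] :
    Function.Exact (homRestrict X Y) (homDiff X Y) := by
  intro f
  constructor
  · intro h
    exact ⟨⟨f, fun {i j} a => (sub_eq_zero.1 (congrFun h ⟨i, j, a⟩)).symm⟩, rfl⟩
  · rintro ⟨g, rfl⟩
    funext a
    exact sub_eq_zero.2 (g.comm a.hom).symm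

/-- The identification of morphisms with extension classes of degree zero. -/
noncomputable def homArrowEquiv [∀ i, HasExt.{w} (Φ.obj i)] :
    (∀ a : Quiver.Total Q, (X.obj a.left ⟶ (Φ.map a.hom).obj (Y.obj a.right))) ≃+
      ∀ a : Quiver.Total Q, Ext.{w} (X.obj a.left) ((Φ.map a.hom).obj (Y.obj a.right)) 0 :=
  AddEquiv.piCongrRight fun _ => Ext.addEquiv₀.symm

/-- The identification of morphisms with extension classes of degree zero. -/
noncomputable def homVertexEquiv [∀ i, HasExt.{w} (Φ.obj i)] :
    (∀ i : Q, (X.obj i ⟶ Y.obj i)) ≃+ ∀ i : Q, Ext.{w} (X.obj i) (Y.obj i) 0 :=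
  AddEquiv.piCongrRight fun _ => Ext.addEquiv₀.symm

lemma extDiff_homVertexEquiv [Φ.IsExact] [∀ i, IsGrothendieckAbelian.{w} (Φ.obj i)]
    (f : ∀ i : Q, (X.obj i ⟶ Y.obj i)) :
    extDiff.{w} X Y 0 (homVertexEquiv.{w} X Y f) =
      homArrowEquiv.{w} X Y (homDiff X Y f) := by
  funext a
  change (Ext.mk₀ (X.map a.hom)).comp
    ((Ext.mk₀ (f a.right)).mapExactFunctor (Φ.map a.hom)) (zero_add 0) -
      (Ext.mk₀ (f a.left)).comp (Ext.mk₀ (Y.map a.hom)) (add_zero 0) =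
    Ext.mk₀ (X.map a.hom ≫ (Φ.map a.hom).map (f a.right) - f a.left ≫ Y.map a.hom)
  rw [Ext.mapExactFunctor_mk₀, Ext.mk₀_comp_mk₀, Ext.mk₀_comp_mk₀, sub_eq_add_neg, ← Ext.mk₀_neg,
    ← Ext.mk₀_add, ← sub_eq_add_neg]

end Hom

end DRep

end QuiverDiagram

theorem mainTheorem2 {Q : Type u₁} [Quiver.{v₁} Q] [Finite Q] [Finite (Quiver.Total Q)]
    (hQ : IsAcyclicQuiver Q)
    (Φ : QuiverDiagram.{v, u} Q) [∀ i, Abelian (Φ.obj i)]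
    [∀ i, IsGrothendieckAbelian.{w} (Φ.obj i)] [Φ.IsExact] (X Y : Φ.DRep) :
    ∃ (δ₀ : (∀ a : Quiver.Total Q, (X.obj a.left ⟶ (Φ.map a.hom).obj (Y.obj a.right))) →+
          Ext.{max u₁ v₁ u v} X Y 1)
      (δ : ∀ n : ℕ,
        (∀ a : Quiver.Total Q,
          Ext.{w} (X.obj a.left) ((Φ.map a.hom).obj (Y.obj a.right)) (n + 1)) →+
            Ext.{max u₁ v₁ u v} X Y (n + 2)),
      Function.Injective (QuiverDiagram.DRep.homRestrict X Y) ∧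
      Function.Exact (QuiverDiagram.DRep.homRestrict X Y) (QuiverDiagram.DRep.homDiff X Y) ∧
      Function.Exact (QuiverDiagram.DRep.homDiff X Y) δ₀ ∧
      Function.Exact δ₀ (QuiverDiagram.DRep.extRestrict.{w} X Y 1) ∧
      ∀ n : ℕ,
        Function.Exact (QuiverDiagram.DRep.extRestrict.{w} X Y (n + 1))
          (QuiverDiagram.DRep.extDiff.{w} X Y (n + 1)) ∧
        Function.Exact (QuiverDiagram.DRep.extDiff.{w} X Y (n + 1)) (δ n) ∧
        Function.Exact (δ n) (QuiverDiagram.DRep.extRestrict.{w} X Y (n + 2)) := by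
  open QuiverDiagram QuiverDiagram.DRep in
  have := OutPath.finite hQ (fun _ : Q => Unit)
  have := OutPath.finite hQ (fun k : Q => Σ j, (k ⟶ j))
  -- The connecting map in degree zero starts from `Ext⁰`, so `δ₀` is precomposed with the
  -- identification of `Hom` with `Ext⁰`.
  refine ⟨(extConnecting.{w} X Y 0).comp (homArrowEquiv.{w} X Y).toAddMonoidHom,
    fun n => extConnecting.{w} X Y (n + 1), homRestrict_injective X Y,
    exact_homRestrict_homDiff X Y, ?_, ?_, fun n => ⟨exact_extRestrict_extDiff X Y (n + 1),
      exact_extDiff_extConnecting X Y (n + 1), exact_extConnecting_extRestrict X Y (n + 1)⟩⟩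
  · refine (Function.Exact.iff_of_ladder_addEquiv (e₁ := homVertexEquiv.{w} X Y)
      (e₂ := homArrowEquiv.{w} X Y) (e₃ := AddEquiv.refl _) ?_ ?_).1
      (exact_extDiff_extConnecting.{w} X Y 0)
    · ext1 f
      exact extDiff_homVertexEquiv X Y f
    · rfl
  · refine (Function.Exact.iff_of_ladder_addEquiv (e₁ := homArrowEquiv.{w} X Y)
      (e₂ := AddEquiv.refl _) (e₃ := AddEquiv.refl _) ?_ ?_).1
      (exact_extConnecting_extRestrict.{w} X Y 0)
    · rfl
    · rfl
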